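/- Notation. $B_E(0,r)$ is the closed ball of radius $r$ in a subspace $E\subset\mathbb{R}^n$, $\operatorname{int}B_E(0,r)$ its interior relative to $E$, $\delta_C$ the indicator function of $C$, $\partial$ the limiting (Mordukhovich) subdifferential, and $N_C=\partial\delta_C$ the limiting normal cone. A function $\varphi$ is *prox-regular at $\bar z$ for $\bar w\in\partial\varphi(\bar z)$ with respect to $r>0$ and $\rho\ge0$* if $\varphi$ is finite and locally l.s.c. at $\bar z$ and $$\varphi(z')\ \ge\ \varphi(z)+\langle w,z'-z\rangle-\tfrac{\rho}{2}\|z'-z\|^2\quad\text{for all } z' \text{ with }\|z'-\bar z\|\le r$$ whenever $w\in\partial\varphi(z)$, $\|w-\bar w\|<r$, $\|z-\bar z\|<r$ and $\varphi(z)<\varphi(\bar z)+r$. It is *prox-regular at $\bar z$ with respect to $r$ and $\rho$* if it is finite and locally l.s.c. at $\bar z$ and this holds for every $\bar w\in\partial \varphi(\bar z)$, with the same $r$ and $\rho$. A set $C$ is prox-regular at $\bar z\in C$ for $\bar w\in N_C(\bar z)$ with respect to $r$ and $\rho$ if $\delta_C$ is. The function $f$ is *properly prox-regular at $\bar x$ with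 respect to $\bar\epsilon$ and $\rho$* if it is prox-regular at $\bar x$ with respect to $\bar\epsilon$ and $\rho$ and, for every $g$ with $(g,-1)\in N_{\operatorname{epi}f}(\bar x,f(\bar x))$, the set $\operatorname{epi}f$ is prox-regular at $(\bar x,f(\bar x))$ for $(g,-1)$ with respect to $\bar\epsilon$ and $\rho$. **Theorem.** Let $f\colon\mathbb{R}^n\to\overline{\mathbb{R}}$ be proper, l.s.c. and properly prox-regular at $\bar x$ with respect to $\bar\epsilon>0$ and $\rho\ge 0$. Let $\epsilon>0$, let $\mathcal V$ be a subspace of $\mathbb{R}^n$, $\mathcal U=\mathcal V^\perp$, and write $x_u,x_v$ for the orthogonal projections of $x$ onto $\mathcal U,\mathcal V$. Let $\bar g$ satisfy $\bar g+\operatorname{int}B_{\mathcal V}(0,\epsilon)\subset\partial f(\bar x)$. For $u\in\mathcal U$, $v\in\mathcal V$ put $$h(u,v)=f(\bar x+u+v)-\langle\bar g_v,v\rangle+\delta_{B_{\mathcal V}(0,\epsilon)}(v),$$ $$L_\epsilon(u)=\inf_{v\in B_{\mathcal V}(0,\epsilon)}\{f(\bar x+u+v)-\langle\bar g_v,v\rangle\},\qquad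 W(u)=\operatorname*{argmin}_{v\in B_{\mathcal V}(0,\epsilon)}\{f(\bar x+u+v)-\langle\bar g_v,v\rangle\},$$ where by convention $W(u)=\emptyset$ if the infimum is $+\infty$. Then: (i) $h$ is proper and l.s.c. on $\mathcal U\times\mathcal V$ and level-bounded in $v$ locally uniformly in $u$: for all $u_0\in\mathcal U$ and $\alpha\in\mathbb{R}$ there are a neighbourhood $N$ of $u_0$ and a bounded $B\subset\mathcal V$ with $\{v: h(u,v)\le\alpha\}\subset B$ for all $u\in N$. (ii) $\partial h(0,0)=\{(g_u,g_v-\bar g_v): g\in\partial f(\bar x)\}$, and $h$ is prox-regular at $(0,0)$ with respect to $\min\{\epsilon,\ \bar\epsilon/(1+\|\bar g_v\|)\}$ and $\rho$. (iii) $L_\epsilon$ is proper and l.s.c. on $\mathcal U$; $W(u)$ is nonempty and compact for each $u\in\operatorname{dom}L_\epsilon=\{u: L_\epsilon(u)<+\infty\}$, and $W(u)=\emptyset$ for $u\notin\operatorname{dom}L_\epsilon$. (iv) For each $u\in\mathcal U$ and each $s\in\partial L_\epsilon(u)$ there is $\hat v\in W(u)$ with $(s,0)\in\partial h(u,\hat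 v)$. -/

import Mathlib

open Filter Topology

noncomputable section

namespace ULag

section General

variable {E : Type*} [NormedAddCommGroup E] [InnerProductSpace ℝ E]

/-- A function is finite at a point when its value there is neither `-∞` nor `+∞`. -/
def FiniteAt {X : Type*} (f : X → EReal) (x : X) : Prop := f x ≠ ⊥ ∧ f x ≠ ⊤

/-- A proper function: never `-∞`, and not identically `+∞`. -/
def IsProper {X : Type*} (f : X → EReal) : Prop := (∀ x, f x ≠ ⊥) ∧ ∃ x, f x ≠ ⊤

/-- The effective domain. -/
def effDom {X : Type*} (f : X → EReal) : Set X := {x | f x < ⊤}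

open Classical in
/-- The indicator function of a set: `0` on the set, `+∞` off it. -/
def indicatorFn {X : Type*} (C : Set X) (x : X) : EReal := if x ∈ C then 0 else ⊤

/-- The minimizers of `φ` over `C`. As usual in variational analysis this set is empty when the
infimum of `φ` over `C` is `+∞`. -/
def argminOn {X : Type*} (φ : X → EReal) (C : Set X) : Set X :=
  {x | x ∈ C ∧ φ x = (⨅ y ∈ C, φ y) ∧ (⨅ y ∈ C, φ y) ≠ ⊤}

/-- The regular (Fréchet) subdifferential: `f` is finite at `x` and
`f y ≥ f x + ⟪v, y - x⟫ + o(‖y - x‖)`. -/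
def regularSubdiff (f : E → EReal) (x : E) : Set E :=
  {v | FiniteAt f x ∧ ∀ δ : ℝ, 0 < δ → ∀ᶠ y in 𝓝 x,
    f x + ((inner ℝ v (y - x) - δ * ‖y - x‖ : ℝ) : EReal) ≤ f y}

/-- The limiting (Mordukhovich) subdifferential: limits of regular subgradients along
`f`-attentive sequences. -/
def limitingSubdiff (f : E → EReal) (x : E) : Set E :=
  {v | FiniteAt f x ∧ ∃ (y : ℕ → E) (w : ℕ → E),
    Tendsto y atTop (𝓝 x) ∧ Tendsto (fun k => f (y k)) atTop (𝓝 (f x)) ∧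
    (∀ k, w k ∈ regularSubdiff f (y k)) ∧ Tendsto w atTop (𝓝 v)}

/-- The limiting normal cone of `C` at `x` (empty when `x ∉ C`). -/
def limitingNormals (C : Set E) (x : E) : Set E := limitingSubdiff (indicatorFn C) x

/-- `f` is locally lower semicontinuous at `x`: near `x` the sublevel sets of `f` for levels up
to slightly above `f x` are closed. -/
def LocallyLscAt (f : E → EReal) (x : E) : Prop :=
  ∃ δ : ℝ, 0 < δ ∧ ∀ α : ℝ, (α : EReal) ≤ f x + (δ : EReal) →
    IsClosed {y | y ∈ Metric.closedBall x δ ∧ f y ≤ (α : EReal)}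

/-- `f` is prox-regular at `xbar` for `vbar` with respect to the constants `ε > 0` and `ρ ≥ 0`. -/
structure ProxRegularAtFor (f : E → EReal) (xbar vbar : E) (ε ρ : ℝ) : Prop where
  finite : FiniteAt f xbar
  lsc : LocallyLscAt f xbar
  mem : vbar ∈ limitingSubdiff f xbar
  eps_pos : 0 < ε
  rho_nonneg : 0 ≤ ρ
  ineq : ∀ x v : E, v ∈ limitingSubdiff f x → ‖v - vbar‖ < ε → ‖x - xbar‖ < ε →
    f x < f xbar + (ε : EReal) → ∀ x' ∈ Metric.closedBall xbar ε,
      f x + ((inner ℝ v (x' - x) - ρ / 2 * ‖x' - x‖ ^ 2 : ℝ) : EReal) ≤ f x'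

/-- `f` is prox-regular at `xbar` (for all of its subgradients there) with respect to `ε` and `ρ`;
the constants do not depend on the subgradient. -/
def ProxRegularAt (f : E → EReal) (xbar : E) (ε ρ : ℝ) : Prop :=
  FiniteAt f xbar ∧ LocallyLscAt f xbar ∧ 0 < ε ∧ 0 ≤ ρ ∧
    ∀ vbar ∈ limitingSubdiff f xbar, ProxRegularAtFor f xbar vbar ε ρ

/-- A set is prox-regular at `xbar ∈ C` for the normal `wbar` when its indicator function is. -/
def SetProxRegularAtFor (C : Set E) (xbar wbar : E) (ε ρ : ℝ) : Prop :=
  xbar ∈ C ∧ wbar ∈ limitingNormals C xbar ∧ ProxRegularAtFor (indicatorFn C) xbar wbar ε ρ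

/-- The epigraph of `f`, in `E × ℝ` with its Euclidean structure. -/
def epigraph (f : E → EReal) : Set (WithLp 2 (E × ℝ)) := {p | f p.fst ≤ (p.snd : EReal)}

/-- `f` is properly prox-regular at `xbar` with respect to `ε` and `ρ`: `f` is prox-regular at
`xbar` for every subgradient, and its epigraph is prox-regular at `(xbar, f xbar)` for every
normal of the form `(g, -1)`. -/
def ProperlyProxRegularAt (f : E → EReal) (xbar : E) (ε ρ : ℝ) : Prop :=
  ProxRegularAt f xbar ε ρ ∧
    ∀ g : E,
      WithLp.toLp 2 (g, (-1 : ℝ)) ∈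
        limitingNormals (epigraph f) (WithLp.toLp 2 (xbar, (f xbar).toReal)) →
      SetProxRegularAtFor (epigraph f) (WithLp.toLp 2 (xbar, (f xbar).toReal))
        (WithLp.toLp 2 (g, (-1 : ℝ))) ε ρ

/-- `h (u, v)` is level-bounded in `v` locally uniformly in `u`. -/
def LevelBoundedLocallyUniformly {X Y : Type*} [TopologicalSpace X] [Bornology Y]
    (h : X → Y → EReal) : Prop :=
  ∀ (u₀ : X) (α : ℝ), ∃ N ∈ 𝓝 u₀, ∃ B : Set Y, Bornology.IsBounded B ∧
    ∀ u ∈ N, {v | h u v ≤ (α : EReal)} ⊆ B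

end General

section Lagrangian

variable {n : ℕ}

/-- The set `D_ε f` of all `g` with `g + int B_V(0, ε) ⊆ ∂f(xbar)`, the interior being taken
in the subspace `V`. -/
def Dset (f : EuclideanSpace ℝ (Fin n) → EReal) (xbar : EuclideanSpace ℝ (Fin n))
    (V : Submodule ℝ (EuclideanSpace ℝ (Fin n))) (ε : ℝ) : Set (EuclideanSpace ℝ (Fin n)) :=
  {g | ∀ w ∈ V, ‖w‖ < ε → g + w ∈ limitingSubdiff f xbar}

/-- The function `v ↦ f (xbar + u + v) - ⟪gv, v⟫` on `V`, for a fixed `u` in `U = Vᗮ`. -/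
def tilted (f : EuclideanSpace ℝ (Fin n) → EReal) (xbar : EuclideanSpace ℝ (Fin n))
    (V : Submodule ℝ (EuclideanSpace ℝ (Fin n))) (gv : V) (u : Vᗮ) (v : V) : EReal :=
  f (xbar + (u : EuclideanSpace ℝ (Fin n)) + (v : EuclideanSpace ℝ (Fin n)))
    - ((inner ℝ gv v : ℝ) : EReal)

/-- The U-Lagrangian `L_ε(u; gv)`. -/
def lagrangian (f : EuclideanSpace ℝ (Fin n) → EReal) (xbar : EuclideanSpace ℝ (Fin n))
    (V : Submodule ℝ (EuclideanSpace ℝ (Fin n))) (ε : ℝ) (gv : V) (u : Vᗮ) : EReal :=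
  ⨅ v ∈ Metric.closedBall (0 : V) ε, tilted f xbar V gv u v

/-- The set `W(u; gv)` of `V`-space minimizers. -/
def minimizers (f : EuclideanSpace ℝ (Fin n) → EReal) (xbar : EuclideanSpace ℝ (Fin n))
    (V : Submodule ℝ (EuclideanSpace ℝ (Fin n))) (ε : ℝ) (gv : V) (u : Vᗮ) : Set V :=
  argminOn (tilted f xbar V gv u) (Metric.closedBall (0 : V) ε)

/-- `h(u, v) = f (xbar + u + v) - ⟪gv, v⟫ + δ_{B_V(0, ε)}(v)` on `U × V` with its
Euclidean structure. -/
def hFun (f : EuclideanSpace ℝ (Fin n) → EReal) (xbar : EuclideanSpace ℝ (Fin n))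
    (V : Submodule ℝ (EuclideanSpace ℝ (Fin n))) (ε : ℝ) (gv : V)
    (p : WithLp 2 (Vᗮ × V)) : EReal :=
  tilted f xbar V gv p.fst p.snd + indicatorFn (Metric.closedBall (0 : V) ε) p.snd

end Lagrangian

end ULag

end

open Filter Topology

noncomputable section

namespace ULag

/-! On the strip `‖v‖ ≤ ε`, `hFun` is `f` composed with the rigid motion `(u, v) ↦ xbar + u + v`,
minus the linear functional `⟪(0, gv), ·⟫`. Such a change of variables shifts and rotates
subgradients and carries the inequality defining prox-regularity over with the same `ρ`
(`mem_limitingSubdiff_rigidTilt`, `ProxRegularAt.of_eqOn_rigidTilt`). Only the window of admissible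
values of `f` is affected, and this forces the factor `1 + ‖gv‖`. The statements on the Lagrangian
rest on compactness of the ball in `V`: infima are attained, and partial minimization keeps lower
semicontinuity. If `y` minimizes at `x`, then `L ≤ h` with equality at `(x, y)`, so a regular
subgradient `s` of `L` at `x` lifts to `(s, 0)` for `h`. Limits follow along a convergent
subsequence of minimizers. -/

lemma sub_coe_add_coe_le_sub_coe_iff (a b : EReal) (r s t : ℝ) :
    a - (s : EReal) + (r : EReal) ≤ b - (t : EReal) ↔ a + ((r - s + t : ℝ) : EReal) ≤ b := by
  induction a using EReal.rec with
  | bot => simp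
  | top =>
    induction b using EReal.rec with
    | bot => simp [-EReal.coe_sub]
    | top => simp
    | coe b => simp [← EReal.coe_sub]
  | coe a =>
    induction b using EReal.rec with
    | bot => simp [← EReal.coe_add, ← EReal.coe_sub]
    | top => simp
    | coe b =>
      norm_cast
      constructor <;> intro h <;> linarith

lemma sub_coe_ne_bot_iff {a : EReal} {r : ℝ} : a - (r : EReal) ≠ ⊥ ↔ a ≠ ⊥ := by
  induction a using EReal.rec <;> simp [← EReal.coe_sub]

lemma sub_coe_ne_top_iff {a : EReal} {r : ℝ} : a - (r : EReal) ≠ ⊤ ↔ a ≠ ⊤ := by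
  induction a using EReal.rec <;> simp [← EReal.coe_sub]

/-- Addition on `EReal` is continuous wherever one summand is real, even if the other is infinite,
and subtracting a real number is undone by adding it back. -/
lemma tendsto_sub_coe_iff {ι : Type*} {l : Filter ι} {a : ι → EReal} {b : EReal} {r : ι → ℝ}
    {s : ℝ} (hr : Tendsto r l (𝓝 s)) :
    Tendsto (fun i => a i - (r i : EReal)) l (𝓝 (b - (s : EReal))) ↔ Tendsto a l (𝓝 b) := by
  have aux : ∀ {a : ι → EReal} {b : EReal} {r : ι → ℝ} {s : ℝ}, Tendsto r l (𝓝 s) →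
      Tendsto a l (𝓝 b) → Tendsto (fun i => a i + (r i : EReal)) l (𝓝 (b + (s : EReal))) := by
    intro a b r s hr ha
    have hc := EReal.continuousAt_add (p := (b, (s : EReal))) (by simp) (by simp)
    exact hc.tendsto.comp (ha.prodMk_nhds (EReal.tendsto_coe.2 hr))
  constructor
  · intro h
    have := aux hr h
    simpa [EReal.sub_add_cancel] using this
  · intro h
    have := aux hr.neg h
    simpa [sub_eq_add_neg] using this

lemma locallyLscAt_of_lowerSemicontinuous {E : Type*} [NormedAddCommGroup E] {f : E → EReal}
    (hf : LowerSemicontinuous f) (x : E) : LocallyLscAt f x :=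
  ⟨1, one_pos, fun α _ => Metric.isClosed_closedBall.inter (hf.isClosed_preimage α)⟩

/-! ### Subgradients and prox-regularity under rigid motions and tilts -/

section Subdiff

variable {E F : Type*} [NormedAddCommGroup E] [InnerProductSpace ℝ E]
  [NormedAddCommGroup F] [InnerProductSpace ℝ F]

lemma regularSubdiff_congr {f g : E → EReal} {x : E} (h : f =ᶠ[𝓝 x] g) :
    regularSubdiff f x = regularSubdiff g x := by
  have aux : ∀ {f g : E → EReal}, f =ᶠ[𝓝 x] g → regularSubdiff f x ⊆ regularSubdiff g x := by
    intro f g h v hv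
    have hx := h.eq_of_nhds
    refine ⟨by simpa only [FiniteAt, hx] using hv.1, fun δ hδ => ?_⟩
    filter_upwards [hv.2 δ hδ, h] with y hy hfg
    rwa [← hx, ← hfg]
  exact (aux h).antisymm (aux h.symm)

lemma limitingSubdiff_congr {f g : E → EReal} {x : E} (h : f =ᶠ[𝓝 x] g) :
    limitingSubdiff f x = limitingSubdiff g x := by
  have aux : ∀ {f g : E → EReal}, f =ᶠ[𝓝 x] g → limitingSubdiff f x ⊆ limitingSubdiff g x := by
    rintro f g h v ⟨hfin, y, w, hy, hfy, hw, hwv⟩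
    have hx := h.eq_of_nhds
    -- Dropping the first `N` terms leaves only points near which `f` and `g` agree.
    obtain ⟨N, hN⟩ := eventually_atTop.1 (hy.eventually h.eventuallyEq_nhds)
    have hshift := tendsto_add_atTop_nat N
    refine ⟨by simpa only [FiniteAt, hx] using hfin, fun k => y (k + N), fun k => w (k + N),
      hy.comp hshift, ?_, fun k => ?_, hwv.comp hshift⟩
    · rw [← hx]
      refine (hfy.comp hshift).congr fun k => ?_
      exact (hN (k + N) (Nat.le_add_left _ _)).eq_of_nhds
    · rw [← regularSubdiff_congr (hN (k + N) (Nat.le_add_left _ _))]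
      exact hw _
  exact (aux h).antisymm (aux h.symm)

/-- Composition with a rigid motion followed by subtraction of a linear functional. -/
def rigidTilt (f : E → EReal) (c : E) (Φ : F ≃ₗᵢ[ℝ] E) (b : F) (q : F) : EReal :=
  f (c + Φ q) - ((inner ℝ b q : ℝ) : EReal)

variable {f : E → EReal} {c : E} {Φ : F ≃ₗᵢ[ℝ] E} {b : F}

lemma finiteAt_rigidTilt {p : F} : FiniteAt (rigidTilt f c Φ b) p ↔ FiniteAt f (c + Φ p) :=
  and_congr sub_coe_ne_bot_iff sub_coe_ne_top_iff

/-- The error `r` is arbitrary, so one equivalence serves both the `δ * ‖·‖` term of regular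
subgradients and the quadratic term of prox-regularity. -/
lemma rigidTilt_subgradient_ineq_iff (p q w : F) (r : ℝ) :
    rigidTilt f c Φ b p + ((inner ℝ w (q - p) - r : ℝ) : EReal) ≤ rigidTilt f c Φ b q ↔
      f (c + Φ p) + ((inner ℝ (Φ (w + b)) (c + Φ q - (c + Φ p)) - r : ℝ) : EReal) ≤
        f (c + Φ q) := by
  rw [rigidTilt, rigidTilt, sub_coe_add_coe_le_sub_coe_iff]
  have : inner ℝ (Φ (w + b)) (c + Φ q - (c + Φ p)) = (inner ℝ (w + b) (q - p) : ℝ) := by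
    rw [add_sub_add_left_eq_sub, ← map_sub, LinearIsometryEquiv.inner_map_map]
  rw [this, inner_add_left, inner_sub_right b]
  ring_nf

lemma norm_rigid_sub (p q : F) : ‖c + Φ q - (c + Φ p)‖ = ‖q - p‖ := by
  rw [add_sub_add_left_eq_sub, ← map_sub, LinearIsometryEquiv.norm_map]

lemma map_nhds_rigid (c : E) (Φ : F ≃ₗᵢ[ℝ] E) (p : F) :
    map (fun q => c + Φ q) (𝓝 p) = 𝓝 (c + Φ p) :=
  (Φ.toHomeomorph.trans (Homeomorph.addLeft c)).map_nhds_eq p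

lemma mem_regularSubdiff_rigidTilt {p w : F} :
    w ∈ regularSubdiff (rigidTilt f c Φ b) p ↔ Φ (w + b) ∈ regularSubdiff f (c + Φ p) := by
  refine and_congr finiteAt_rigidTilt (forall₂_congr fun δ _ => ?_)
  rw [← map_nhds_rigid, eventually_map]
  refine eventually_congr (Eventually.of_forall fun q => ?_)
  rw [rigidTilt_subgradient_ineq_iff, norm_rigid_sub]

/-- The tilt is continuous, so it preserves attentive convergence, and the motion is invertible, so
sequences transport both ways. -/
lemma mem_limitingSubdiff_rigidTilt {p w : F} :
    w ∈ limitingSubdiff (rigidTilt f c Φ b) p ↔ Φ (w + b) ∈ limitingSubdiff f (c + Φ p) := by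
  have hinner : ∀ {y : ℕ → F}, Tendsto y atTop (𝓝 p) →
      Tendsto (fun k => (inner ℝ b (y k) : ℝ)) atTop (𝓝 (inner ℝ b p)) := fun hy =>
    tendsto_const_nhds.inner hy
  refine and_congr finiteAt_rigidTilt ⟨?_, ?_⟩
  · rintro ⟨y, v, hy, hfy, hv, hvw⟩
    refine ⟨fun k => c + Φ (y k), fun k => Φ (v k + b), ?_, ?_,
      fun k => mem_regularSubdiff_rigidTilt.1 (hv k), ?_⟩
    · exact tendsto_const_nhds.add ((Φ.continuous.tendsto p).comp hy)
    · exact (tendsto_sub_coe_iff (hinner hy)).1 hfy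
    · exact (Φ.continuous.tendsto _).comp (hvw.add_const b)
  · rintro ⟨y, v, hy, hfy, hv, hvw⟩
    have hy' : ∀ k, c + Φ (Φ.symm (y k - c)) = y k := fun k => by simp
    have hlim : Tendsto (fun k => Φ.symm (y k - c)) atTop (𝓝 p) := by
      have := (Φ.symm.continuous.tendsto _).comp (hy.sub_const c)
      simpa [Function.comp_def] using this
    refine ⟨fun k => Φ.symm (y k - c), fun k => Φ.symm (v k) - b, hlim, ?_, fun k => ?_, ?_⟩
    · refine (tendsto_sub_coe_iff (hinner hlim)).2 ?_
      simpa only [hy'] using hfy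
    · rw [mem_regularSubdiff_rigidTilt, hy']
      simpa using hv k
    · have := ((Φ.symm.continuous.tendsto _).comp hvw).sub_const b
      simpa using this

lemma lowerSemicontinuous_rigidTilt (hf : LowerSemicontinuous f) :
    LowerSemicontinuous (rigidTilt f c Φ b) := by
  have hcomp : LowerSemicontinuous fun q : F => f (c + Φ q) :=
    hf.comp (continuous_const.add Φ.continuous)
  have hlin : Continuous fun q : F => ((-(inner ℝ b q) : ℝ) : EReal) :=
    continuous_coe_real_ereal.comp (continuous_const.inner continuous_id).neg
  have hadd := hcomp.add' hlin.lowerSemicontinuous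
    fun q => EReal.continuousAt_add (by simp) (by simp)
  have heq : rigidTilt f c Φ b = fun q => f (c + Φ q) + ((-(inner ℝ b q) : ℝ) : EReal) := by
    ext q
    rw [rigidTilt, sub_eq_add_neg, EReal.coe_neg]
  rwa [heq]

/-- Prox-regularity passes to a function that coincides near `0` with a tilted rigid motion of a
prox-regular one. -/
lemma ProxRegularAt.of_eqOn_rigidTilt {ε ρ r : ℝ} (hf : ProxRegularAt f c ε ρ) {h : F → EReal}
    (hh : LowerSemicontinuous h) (hr : 0 < r) (hrε : r * (1 + ‖b‖) ≤ ε)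
    (heq : Set.EqOn h (rigidTilt f c Φ b) (Metric.closedBall 0 r)) :
    ProxRegularAt h 0 r ρ := by
  obtain ⟨hfin, -, -, hρ, hprox⟩ := hf
  have hev : ∀ x : F, ‖x‖ < r → h =ᶠ[𝓝 x] rigidTilt f c Φ b := fun x hx =>
    heq.eventuallyEq_of_mem (mem_of_superset
      (Metric.isOpen_ball.mem_nhds (mem_ball_zero_iff.2 hx)) Metric.ball_subset_closedBall)
  have hrε' : r ≤ ε := by nlinarith [norm_nonneg b]
  have h0 := hev 0 (by simpa using hr)
  have hfin' : FiniteAt h 0 := by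
    have : FiniteAt (rigidTilt f c Φ b) 0 := finiteAt_rigidTilt.2 (by simpa using hfin)
    simpa only [FiniteAt, h0.eq_of_nhds] using this
  refine ⟨hfin', locallyLscAt_of_lowerSemicontinuous hh 0, hr, hρ, fun wbar hwbar =>
    ⟨hfin', locallyLscAt_of_lowerSemicontinuous hh 0, hwbar, hr, hρ, ?_⟩⟩
  intro x w hw hwr hxr hval x' hx'
  rw [sub_zero] at hxr
  rw [limitingSubdiff_congr h0, mem_limitingSubdiff_rigidTilt, map_zero, add_zero] at hwbar
  rw [limitingSubdiff_congr (hev x hxr), mem_limitingSubdiff_rigidTilt] at hw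
  rw [(hev x hxr).eq_of_nhds, h0.eq_of_nhds] at hval
  rw [(hev x hxr).eq_of_nhds, heq hx', rigidTilt_subgradient_ineq_iff]
  have key := (hprox _ hwbar).ineq (c + Φ x) (Φ (w + b)) hw ?_ ?_ ?_ (c + Φ x') ?_
  · rwa [norm_rigid_sub] at key
  · rw [← map_sub, LinearIsometryEquiv.norm_map, add_sub_add_right_eq_sub]
    exact hwr.trans_le hrε'
  · rw [add_sub_cancel_left, LinearIsometryEquiv.norm_map]
    exact hxr.trans_le hrε'
  -- Undoing the tilt raises the bound on the value by `⟪b, x⟫ ≤ ‖b‖ * r`; the total excess is below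
  -- `r * (1 + ‖b‖) ≤ ε`.
  · have hle : (inner ℝ b x : ℝ) ≤ ‖b‖ * r :=
      (real_inner_le_norm b x).trans (mul_le_mul_of_nonneg_left hxr.le (norm_nonneg b))
    simp only [rigidTilt, map_zero, add_zero, inner_zero_right, EReal.coe_zero, sub_zero] at hval
    have hxfin := hw.1
    generalize f (c + Φ x) = A at hval hxfin ⊢
    have hB := hfin
    unfold FiniteAt at hB
    generalize f c = B at hval hB ⊢
    lift B to ℝ using ⟨hB.2, hB.1⟩
    induction A using EReal.rec with
    | bot => exact EReal.bot_lt_coe _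
    | top => simp at hval
    | coe a =>
      norm_cast at hval ⊢
      nlinarith
  · rw [mem_closedBall_iff_norm, add_sub_cancel_left, LinearIsometryEquiv.norm_map]
    exact (mem_closedBall_zero_iff.1 hx').trans hrε'

end Subdiff

/-! ### Partial minimization over a compact set -/

section Marginal

variable {X Y : Type*} [TopologicalSpace X] [TopologicalSpace Y]

lemma exists_biInf_eq_of_isCompact {φ : Y → EReal} (hφ : LowerSemicontinuous φ) {K : Set Y}
    (hK : IsCompact K) (hne : K.Nonempty) : ∃ y ∈ K, φ y = ⨅ z ∈ K, φ z := by
  obtain ⟨y, hy, hmin⟩ := (hφ.lowerSemicontinuousOn K).exists_isMinOn hne hK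
  exact ⟨y, hy, le_antisymm (le_iInf₂ fun z hz => hmin hz) (iInf₂_le y hy)⟩

lemma isCompact_argminOn {φ : Y → EReal} (hφ : LowerSemicontinuous φ) {K : Set Y}
    (hK : IsCompact K) : IsCompact (argminOn φ K) := by
  by_cases htop : (⨅ y ∈ K, φ y) = ⊤
  · have : argminOn φ K = ∅ := Set.eq_empty_of_forall_notMem fun x hx => hx.2.2 htop
    rw [this]
    exact isCompact_empty
  · have : argminOn φ K = K ∩ φ ⁻¹' Set.Iic (⨅ y ∈ K, φ y) := by
      ext x
      exact ⟨fun hx => ⟨hx.1, hx.2.1.le⟩, fun hx => ⟨hx.1, le_antisymm hx.2 (iInf₂_le x hx.1), htop⟩⟩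
    rw [this]
    exact hK.inter_right (hφ.isClosed_preimage _)

/-- By compactness a strict lower bound on the slice at `x` persists over all of `K` for nearby
`x'`; attainment keeps it strict for the infimum. -/
lemma lowerSemicontinuous_biInf_of_isCompact {H : X → Y → EReal}
    (hH : LowerSemicontinuous (Function.uncurry H)) {K : Set Y} (hK : IsCompact K)
    (hne : K.Nonempty) : LowerSemicontinuous fun x => ⨅ y ∈ K, H x y := by
  intro x a ha
  have hev : ∀ᶠ x' in 𝓝 x, ∀ y ∈ K, a < H x' y :=
    hK.eventually_forall_of_forall_eventually fun y hy => hH (x, y) a (ha.trans_le (iInf₂_le y hy))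
  filter_upwards [hev] with x' hx'
  obtain ⟨y, hy, hmin⟩ := exists_biInf_eq_of_isCompact
    (hH.comp (Continuous.prodMk_right x')) hK hne
  exact (hx' y hy).trans_eq hmin

end Marginal

lemma lowerSemicontinuous_indicatorFn {X : Type*} [TopologicalSpace X] {C : Set X}
    (hC : IsClosed C) : LowerSemicontinuous (indicatorFn C) := by
  intro x a ha
  by_cases hx : x ∈ C
  · have h0 : a < 0 := by simpa [indicatorFn, hx] using ha
    refine Eventually.of_forall fun y => h0.trans_le ?_
    unfold indicatorFn
    split_ifs <;> simp
  · filter_upwards [hC.isOpen_compl.mem_nhds hx] with y hy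
    have hy' : y ∉ C := hy
    simpa [indicatorFn, hx, hy'] using ha

/-! ### Subgradients of marginal functions -/

section MarginalSubdiff

variable {X Y : Type*} [NormedAddCommGroup X] [InnerProductSpace ℝ X]
  [NormedAddCommGroup Y] [InnerProductSpace ℝ Y]

/-- Subgradients of a marginal function come from subgradients of the parent function at a
minimizer. -/
lemma exists_argmin_mem_limitingSubdiff {H : WithLp 2 (X × Y) → EReal} {φ : X → Y → EReal}
    {K : Set Y} (hH : LowerSemicontinuous H) (hle : ∀ p, ⨅ y ∈ K, φ p.fst y ≤ H p)
    (heq : ∀ x, ∀ y ∈ K, H (WithLp.toLp 2 (x, y)) = φ x y)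
    (hφ : ∀ x, LowerSemicontinuous (φ x)) (hK : IsCompact K) (hne : K.Nonempty) {x s : X}
    (hs : s ∈ limitingSubdiff (fun x => ⨅ y ∈ K, φ x y) x) :
    ∃ y ∈ argminOn (φ x) K,
      WithLp.toLp 2 (s, (0 : Y)) ∈ limitingSubdiff H (WithLp.toLp 2 (x, y)) := by
  obtain ⟨hfin, a, w, ha, hfa, hw, hws⟩ := hs
  choose y hyK hymin using fun k => exists_biInf_eq_of_isCompact (hφ (a k)) hK hne
  have hval : ∀ k, H (WithLp.toLp 2 (a k, y k)) = ⨅ z ∈ K, φ (a k) z := fun k => by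
    rw [heq _ _ (hyK k), hymin k]
  obtain ⟨y₀, hy₀, σ, hσ, hlim⟩ := hK.tendsto_subseq hyK
  have hσ' := hσ.tendsto_atTop
  have hpair : Tendsto (fun k => WithLp.toLp 2 (a (σ k), y (σ k))) atTop
      (𝓝 (WithLp.toLp 2 (x, y₀))) :=
    ((WithLp.prod_continuous_toLp 2 X Y).tendsto _).comp ((ha.comp hσ').prodMk_nhds hlim)
  have hHlim : Tendsto (fun k => H (WithLp.toLp 2 (a (σ k), y (σ k)))) atTop
      (𝓝 (⨅ z ∈ K, φ x z)) := by
    simp only [hval]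
    exact hfa.comp hσ'
  -- Lower semicontinuity bounds `H` at the limit by the limit of the infima, so `y₀` is again a
  -- minimizer; this also makes the convergence attentive for `H`.
  have hHx : H (WithLp.toLp 2 (x, y₀)) = ⨅ z ∈ K, φ x z := by
    refine le_antisymm (le_of_forall_lt fun c hc => ?_) (hle (WithLp.toLp 2 (x, y₀)))
    obtain ⟨d, hcd, hd⟩ := exists_between hc
    exact hcd.trans_le (ge_of_tendsto hHlim
      ((hpair.eventually (hH _ d hd)).mono fun k hk => le_of_lt hk))
  refine ⟨y₀, ⟨hy₀, by rw [← heq x y₀ hy₀, hHx], hfin.2⟩, by simpa only [FiniteAt, hHx] using hfin,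
    _, fun k => WithLp.toLp 2 (w (σ k), 0), hpair, by rwa [hHx], fun k => ?_, ?_⟩
  · obtain ⟨hfink, hk⟩ := hw (σ k)
    refine ⟨by simpa only [FiniteAt, hval] using hfink, fun δ hδ => ?_⟩
    have hfst : Tendsto (fun p : WithLp 2 (X × Y) => p.fst)
        (𝓝 (WithLp.toLp 2 (a (σ k), y (σ k)))) (𝓝 (a (σ k))) :=
      (continuous_fst.comp (WithLp.prod_continuous_ofLp 2 X Y)).tendsto _
    filter_upwards [hfst.eventually (hk δ hδ)] with p hp
    -- The marginal function minorizes `H` and agrees with it at the base point; projecting to `X`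
    -- does not increase the norm, so the error only gets larger in the product.
    refine le_trans ?_ (hp.trans (hle p))
    rw [hval]
    refine add_le_add_right (EReal.coe_le_coe_iff.2 ?_) _
    have hnorm : ‖p.fst - a (σ k)‖ ≤ ‖p - WithLp.toLp 2 (a (σ k), y (σ k))‖ :=
      WithLp.norm_fst_le _ (p - WithLp.toLp 2 (a (σ k), y (σ k)))
    have hinner : (inner ℝ (WithLp.toLp 2 (w (σ k), (0 : Y)))
        (p - WithLp.toLp 2 (a (σ k), y (σ k))) : ℝ) = inner ℝ (w (σ k)) (p.fst - a (σ k)) := by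
      simp
    rw [hinner]
    gcongr
  · exact ((WithLp.prod_continuous_toLp 2 X Y).tendsto (s, 0)).comp
      ((hws.comp hσ').prodMk_nhds tendsto_const_nhds)

end MarginalSubdiff

/-! ### The function `hFun` as a tilted rigid motion of `f` -/

section Lagrangian

variable {n : ℕ}

/-- The isometry `(u, v) ↦ u + v` of `Vᗮ × V` onto the whole space. -/
def sumIsometry (V : Submodule ℝ (EuclideanSpace ℝ (Fin n))) :
    WithLp 2 (Vᗮ × V) ≃ₗᵢ[ℝ] EuclideanSpace ℝ (Fin n) :=
  (V.orthogonalDecomposition.trans (LinearIsometryEquiv.withLpProdComm 2 ℝ V Vᗮ)).symm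

lemma sumIsometry_symm_apply (V : Submodule ℝ (EuclideanSpace ℝ (Fin n)))
    (x : EuclideanSpace ℝ (Fin n)) :
    (sumIsometry V).symm x =
      WithLp.toLp 2 (Vᗮ.orthogonalProjectionOnto x, V.orthogonalProjectionOnto x) := by
  simp [sumIsometry]

lemma sumIsometry_apply (V : Submodule ℝ (EuclideanSpace ℝ (Fin n))) (p : WithLp 2 (Vᗮ × V)) :
    sumIsometry V p = p.fst + p.snd := by
  obtain ⟨x, rfl⟩ := (sumIsometry V).symm.surjective p
  rw [LinearIsometryEquiv.apply_symm_apply, sumIsometry_symm_apply, add_comm]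
  exact (V.starProjection_add_starProjection_orthogonal x).symm

variable {f : EuclideanSpace ℝ (Fin n) → EReal} {xbar : EuclideanSpace ℝ (Fin n)}
  {V : Submodule ℝ (EuclideanSpace ℝ (Fin n))} {ε : ℝ} {gv : V}

lemma tilted_eq_rigidTilt (u : Vᗮ) (v : V) :
    tilted f xbar V gv u v =
      rigidTilt f xbar (sumIsometry V) (WithLp.toLp 2 (0, gv)) (WithLp.toLp 2 (u, v)) := by
  simp [tilted, rigidTilt, sumIsometry_apply, add_assoc]

lemma hFun_eq_of_mem {p : WithLp 2 (Vᗮ × V)} (hp : p.snd ∈ Metric.closedBall (0 : V) ε) :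
    hFun f xbar V ε gv p = tilted f xbar V gv p.fst p.snd := by
  rw [hFun, indicatorFn, if_pos hp, add_zero]

lemma tilted_ne_bot (hf : ∀ x, f x ≠ ⊥) (u : Vᗮ) (v : V) : tilted f xbar V gv u v ≠ ⊥ :=
  sub_coe_ne_bot_iff.2 (hf _)

lemma hFun_eq_top_of_notMem (hf : ∀ x, f x ≠ ⊥) {p : WithLp 2 (Vᗮ × V)}
    (hp : p.snd ∉ Metric.closedBall (0 : V) ε) : hFun f xbar V ε gv p = ⊤ := by
  rw [hFun, indicatorFn, if_neg hp, EReal.add_top_of_ne_bot (tilted_ne_bot hf _ _)]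

lemma lagrangian_le_hFun (hf : ∀ x, f x ≠ ⊥) (p : WithLp 2 (Vᗮ × V)) :
    lagrangian f xbar V ε gv p.fst ≤ hFun f xbar V ε gv p := by
  by_cases hp : p.snd ∈ Metric.closedBall (0 : V) ε
  · rw [hFun_eq_of_mem hp]
    exact iInf₂_le p.snd hp
  · rw [hFun_eq_top_of_notMem hf hp]
    exact le_top

lemma hFun_ne_bot (hf : ∀ x, f x ≠ ⊥) (p : WithLp 2 (Vᗮ × V)) : hFun f xbar V ε gv p ≠ ⊥ := by
  by_cases hp : p.snd ∈ Metric.closedBall (0 : V) ε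
  · rw [hFun_eq_of_mem hp]
    exact tilted_ne_bot hf _ _
  · rw [hFun_eq_top_of_notMem hf hp]
    exact top_ne_bot

lemma lowerSemicontinuous_uncurry_tilted (hlsc : LowerSemicontinuous f) :
    LowerSemicontinuous (Function.uncurry (tilted f xbar V gv)) := by
  have heq : Function.uncurry (tilted f xbar V gv) = fun q : Vᗮ × V =>
      rigidTilt f xbar (sumIsometry V) (WithLp.toLp 2 (0, gv)) (WithLp.toLp 2 q) :=
    funext fun q => tilted_eq_rigidTilt q.1 q.2
  rw [heq]
  exact (lowerSemicontinuous_rigidTilt hlsc).comp (WithLp.prod_continuous_toLp 2 _ _)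

lemma lowerSemicontinuous_tilted (hlsc : LowerSemicontinuous f) (u : Vᗮ) :
    LowerSemicontinuous (tilted f xbar V gv u) := by
  have h := (lowerSemicontinuous_uncurry_tilted (f := f) (xbar := xbar) (gv := gv) hlsc).comp
    (Continuous.prodMk_right u)
  exact h

lemma lowerSemicontinuous_hFun (hf : ∀ x, f x ≠ ⊥) (hlsc : LowerSemicontinuous f) :
    LowerSemicontinuous (hFun f xbar V ε gv) := by
  have h1 : LowerSemicontinuous fun p : WithLp 2 (Vᗮ × V) => tilted f xbar V gv p.fst p.snd :=
    (lowerSemicontinuous_uncurry_tilted hlsc).comp (WithLp.prod_continuous_ofLp 2 _ _)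
  have h2 : LowerSemicontinuous fun p : WithLp 2 (Vᗮ × V) =>
      indicatorFn (Metric.closedBall (0 : V) ε) p.snd :=
    (lowerSemicontinuous_indicatorFn Metric.isClosed_closedBall).comp
      (continuous_snd.comp (WithLp.prod_continuous_ofLp 2 _ _))
  -- Neither summand takes the value `-∞`, so `∞ - ∞` never occurs.
  refine h1.add' h2 fun p => EReal.continuousAt_add (Or.inr ?_) (Or.inl (tilted_ne_bot hf _ _))
  unfold indicatorFn
  split_ifs <;> simp

lemma eqOn_hFun_rigidTilt :
    Set.EqOn (hFun f xbar V ε gv) (rigidTilt f xbar (sumIsometry V) (WithLp.toLp 2 (0, gv)))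
      (Metric.closedBall 0 ε) := fun p hp => by
  rw [hFun_eq_of_mem, tilted_eq_rigidTilt]
  · rfl
  · exact mem_closedBall_zero_iff.2 ((WithLp.norm_snd_le _ p).trans (mem_closedBall_zero_iff.1 hp))

lemma levelBoundedLocallyUniformly_hFun (hf : ∀ x, f x ≠ ⊥) :
    LevelBoundedLocallyUniformly
      fun (u : Vᗮ) (v : V) => hFun f xbar V ε gv (WithLp.toLp 2 (u, v)) := by
  refine fun u₀ α => ⟨Set.univ, univ_mem, Metric.closedBall 0 ε, Metric.isBounded_closedBall,
    fun u _ v hv => ?_⟩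
  by_contra hnot
  have hv' : hFun f xbar V ε gv (WithLp.toLp 2 (u, v)) ≤ (α : EReal) := hv
  have htop := hFun_eq_top_of_notMem (xbar := xbar) (gv := gv) hf (p := WithLp.toLp 2 (u, v)) hnot
  rw [htop] at hv'
  exact EReal.coe_ne_top α (top_le_iff.1 hv')

lemma limitingSubdiff_hFun_zero (hε : 0 < ε) :
    limitingSubdiff (hFun f xbar V ε gv) 0 =
      {p | ∃ g ∈ limitingSubdiff f xbar,
        p = WithLp.toLp 2 (Vᗮ.orthogonalProjectionOnto g, V.orthogonalProjectionOnto g - gv)} := by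
  rw [limitingSubdiff_congr
    (eqOn_hFun_rigidTilt.eventuallyEq_of_mem (Metric.closedBall_mem_nhds 0 hε))]
  have hsymm : ∀ g, WithLp.toLp 2 (Vᗮ.orthogonalProjectionOnto g,
      V.orthogonalProjectionOnto g - gv) =
        (sumIsometry V).symm g - WithLp.toLp 2 ((0 : Vᗮ), gv) := fun g => by
    rw [sumIsometry_symm_apply, ← WithLp.toLp_sub, Prod.mk_sub_mk, sub_zero]
  ext p
  simp only [mem_limitingSubdiff_rigidTilt, hsymm, map_zero, add_zero, Set.mem_ofPred_eq]
  refine ⟨fun h => ⟨_, h, by simp⟩, ?_⟩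
  rintro ⟨g, hg, rfl⟩
  simpa using hg

end Lagrangian

end ULag

end

/-! ### Assembly of the four statements -/

theorem mainTheorem8 {n : ℕ} (f : EuclideanSpace ℝ (Fin n) → EReal)
    (xbar : EuclideanSpace ℝ (Fin n)) (εbar ρ : ℝ)
    (hproper : ULag.IsProper f) (hlsc : LowerSemicontinuous f)
    (hprox : ULag.ProperlyProxRegularAt f xbar εbar ρ)
    (V : Submodule ℝ (EuclideanSpace ℝ (Fin n))) (ε : ℝ) (hε : 0 < ε)
    (gbar : EuclideanSpace ℝ (Fin n)) (hgbar : gbar ∈ ULag.Dset f xbar V ε)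
    (gbarV : V) (hgbarV : gbarV = V.orthogonalProjectionOnto gbar) :
    -- (i)
    (ULag.IsProper (ULag.hFun f xbar V ε gbarV) ∧
      LowerSemicontinuous (ULag.hFun f xbar V ε gbarV) ∧
      ULag.LevelBoundedLocallyUniformly
        (fun (u : Vᗮ) (v : V) => ULag.hFun f xbar V ε gbarV (WithLp.toLp 2 (u, v)))) ∧
    -- (ii)
    (ULag.limitingSubdiff (ULag.hFun f xbar V ε gbarV) 0 =
        {p | ∃ g ∈ ULag.limitingSubdiff f xbar,
          p = WithLp.toLp 2 (Vᗮ.orthogonalProjectionOnto g, V.orthogonalProjectionOnto g - gbarV)} ∧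
      ULag.ProxRegularAt (ULag.hFun f xbar V ε gbarV) 0 (min ε (εbar / (1 + ‖gbarV‖))) ρ) ∧
    -- (iii)
    (ULag.IsProper (ULag.lagrangian f xbar V ε gbarV) ∧
      LowerSemicontinuous (ULag.lagrangian f xbar V ε gbarV) ∧
      (∀ u ∈ ULag.effDom (ULag.lagrangian f xbar V ε gbarV),
        (ULag.minimizers f xbar V ε gbarV u).Nonempty ∧
          IsCompact (ULag.minimizers f xbar V ε gbarV u)) ∧
      ∀ u ∉ ULag.effDom (ULag.lagrangian f xbar V ε gbarV),
        ULag.minimizers f xbar V ε gbarV u = ∅) ∧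
    -- (iv)
    ∀ (u : Vᗮ), ∀ s ∈ ULag.limitingSubdiff (ULag.lagrangian f xbar V ε gbarV) u,
      ∃ v ∈ ULag.minimizers f xbar V ε gbarV u,
        WithLp.toLp 2 (s, (0 : V)) ∈
          ULag.limitingSubdiff (ULag.hFun f xbar V ε gbarV) (WithLp.toLp 2 (u, v)) := by
  obtain ⟨hbot, -⟩ := hproper
  have hfin := hprox.1.1
  have hεbar := hprox.1.2.2.1
  have hball : IsCompact (Metric.closedBall (0 : V) ε) := isCompact_closedBall 0 ε
  have hne : (Metric.closedBall (0 : V) ε).Nonempty := Metric.nonempty_closedBall.2 hε.le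
  -- The value at the origin is `f xbar`; its finiteness gives properness of both `hFun` and
  -- `lagrangian`.
  have hfin0 : ULag.tilted f xbar V gbarV 0 0 ≠ ⊤ := by
    simpa [ULag.tilted] using hfin.2
  have hmin : ∀ u, ∃ v ∈ Metric.closedBall (0 : V) ε,
      ULag.tilted f xbar V gbarV u v = ULag.lagrangian f xbar V ε gbarV u := fun u =>
    ULag.exists_biInf_eq_of_isCompact (ULag.lowerSemicontinuous_tilted hlsc u) hball hne
  have hLlsc : LowerSemicontinuous (ULag.lagrangian f xbar V ε gbarV) :=
    ULag.lowerSemicontinuous_biInf_of_isCompact (ULag.lowerSemicontinuous_uncurry_tilted hlsc)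
      hball hne
  have hhlsc := ULag.lowerSemicontinuous_hFun (xbar := xbar) (V := V) (ε := ε) (gv := gbarV)
    hbot hlsc
  refine ⟨⟨⟨ULag.hFun_ne_bot hbot, 0, ?_⟩, hhlsc, ULag.levelBoundedLocallyUniformly_hFun hbot⟩,
    ⟨ULag.limitingSubdiff_hFun_zero hε, ?_⟩, ⟨⟨fun u => ?_, 0, ?_⟩, hLlsc, ?_, ?_⟩, ?_⟩
  · rw [ULag.hFun_eq_of_mem (Metric.mem_closedBall_self hε.le)]
    exact hfin0
  · have hpos : 0 < 1 + ‖gbarV‖ := by positivity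
    refine hprox.1.of_eqOn_rigidTilt (Φ := ULag.sumIsometry V) (b := WithLp.toLp 2 (0, gbarV))
      hhlsc (lt_min hε (div_pos hεbar hpos)) ?_
      (ULag.eqOn_hFun_rigidTilt.mono (Metric.closedBall_subset_closedBall (min_le_left _ _)))
    rw [WithLp.norm_toLp_snd, ← le_div_iff₀ hpos]
    exact min_le_right _ _
  · obtain ⟨v, -, hv⟩ := hmin u
    rw [← hv]
    exact ULag.tilted_ne_bot hbot _ _
  · exact ne_top_of_le_ne_top hfin0 (iInf₂_le 0 (Metric.mem_closedBall_self hε.le))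
  · intro u hu
    obtain ⟨v, hv, hvu⟩ := hmin u
    exact ⟨⟨v, hv, hvu, ne_of_lt hu⟩,
      ULag.isCompact_argminOn (ULag.lowerSemicontinuous_tilted hlsc u) hball⟩
  · intro u hu
    exact Set.eq_empty_of_forall_notMem fun v hv => hu (lt_top_iff_ne_top.2 hv.2.2)
  · intro u s hs
    exact ULag.exists_argmin_mem_limitingSubdiff hhlsc (ULag.lagrangian_le_hFun hbot)
      (fun u v hv => ULag.hFun_eq_of_mem (p := WithLp.toLp 2 (u, v)) hv)
      (ULag.lowerSemicontinuous_tilted hlsc) hball hne hs
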